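/- Let $G$ be a countable discrete group and let $X$ be a locally compact, second-countable flow space for $G$, i.e. a metric space with a continuous action of $G\times\mathbb{R}$ such that the action of $G$ is isometric and proper (for every compact $K\subseteq X$ the set $\{g\in G\mid K\cap gK\neq\emptyset\}$ is finite). Write $\Phi_t$ for the action of $t\in\mathbb{R}$. Fix $\gamma>0$, and let $X_{\mathrm{axes}}\subseteq X$ be the subspace of all $x\in X$ such that $\Phi_s x\neq x$ for all $s>0$ and such that $\Phi_t x=gx$ for some $g\in G$ and some $t$ with $0<t\le\gamma$; it is invariant under $G$ and $\Phi$. Then there is a collection $\mathcal{V}$ of open subsets of $X_{\mathrm{axes}}$ such that: 1. every $V\in\mathcal{V}$ is invariant under the flow $\Phi$; 2. $\mathcal{V}$ is a $\mathcal{VC}yc$-cover of $X_{\mathrm{axes}}$: it covers $X_{\mathrm{axes}}$; $gV\in\mathcal{V}$ for all $g\in G$ and $V\in\mathcal{V}$; and for every $V\in\mathcal{V}$ the group $\{g\in G\mid gV=V\}$ is virtually cyclic and $gV\cap V\neq\emptyset$ implies $gV=V$ for all $g \in G$; 3. $\dim\mathcal{V}\le\dim X$. Here the dimension of a collection of sets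 is the dimension of its nerve (so it is at most $n$ if and only if each point lies in at most $n+1$ members), and $\dim X\in\{-1,0,1,\dots,\infty\}$ is the covering dimension of $X$: the least $n$ such that every open cover of $X$ has an open refinement that covers $X$ and has dimension at most $n$. -/

import Mathlib

open scoped Pointwise

namespace FlowSpace

/-! ### Dimension of collections of subsets and covering dimension -/

/-- The dimension of a collection of subsets of `X`, i.e. the dimension of its nerve: the supremum
of `k - 1` over all `k ≥ 1` such that some `k` distinct members have a common point.
The value `⊥` plays the role of `-1`, and `⊤` that of `∞`. -/
noncomputable def collectionDim {X : Type*} (𝒰 : Set (Set X)) : WithBot ℕ∞ :=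
  ⨆ (s : Finset (Set X)) (_ : s.Nonempty ∧ (s : Set (Set X)) ⊆ 𝒰 ∧ (⋂ U ∈ s, U).Nonempty),
    ((s.card - 1 : ℕ) : WithBot ℕ∞)

/-- `𝒰` consists of open sets and covers `X`. -/
def IsOpenCovering {X : Type*} [TopologicalSpace X] (𝒰 : Set (Set X)) : Prop :=
  (∀ U ∈ 𝒰, IsOpen U) ∧ ⋃₀ 𝒰 = Set.univ

/-- `𝒱` is a refinement of `𝒰`. -/
def Refines {X : Type*} (𝒱 𝒰 : Set (Set X)) : Prop :=
  ∀ V ∈ 𝒱, ∃ U ∈ 𝒰, V ⊆ U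

/-- The (Lebesgue) covering dimension of a topological space: the least `n` such that every open
cover has an open refinement which is a cover of dimension at most `n`. It is `⊥` exactly for the
empty space, and `⊤` if there is no finite such `n`. -/
noncomputable def coveringDim (X : Type*) [TopologicalSpace X] : WithBot ℕ∞ :=
  sInf {n : WithBot ℕ∞ | ∀ 𝒰 : Set (Set X), IsOpenCovering 𝒰 →
    ∃ 𝒱 : Set (Set X), IsOpenCovering 𝒱 ∧ Refines 𝒱 𝒰 ∧ collectionDim 𝒱 ≤ n}

/-! ### Families of subgroups -/

/-- A group is virtually cyclic if it has a cyclic subgroup of finite index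
(so finite groups are virtually cyclic). -/
def IsVirtuallyCyclic (G : Type*) [Group G] : Prop :=
  ∃ C : Subgroup G, IsCyclic C ∧ C.FiniteIndex

/-- The family of all virtually cyclic subgroups of `G`. -/
def VCyc (G : Type*) [Group G] : Set (Subgroup G) :=
  {H | IsVirtuallyCyclic H}

/-- An `𝓕`-subset `U` of a `G`-space: every translate `g • U` which meets `U` equals `U`, and the
setwise stabilizer of `U` belongs to `𝓕`. -/
def IsFamilySubset {G X : Type*} [Group G] [MulAction G X] (𝓕 : Set (Subgroup G))
    (U : Set X) : Prop :=
  (∀ g : G, (g • U ∩ U).Nonempty → g • U = U) ∧ MulAction.stabilizer G U ∈ 𝓕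

/-- An `𝓕`-cover of a `G`-space: a `G`-invariant collection of `𝓕`-subsets which covers it. -/
def IsFamilyCover {G X : Type*} [Group G] [MulAction G X] (𝓕 : Set (Subgroup G))
    (𝒱 : Set (Set X)) : Prop :=
  (∀ V ∈ 𝒱, IsFamilySubset 𝓕 V) ∧ (∀ g : G, ∀ V ∈ 𝒱, g • V ∈ 𝒱) ∧ ⋃₀ 𝒱 = Set.univ

/-! ### Flow spaces -/

/-- A metric space `X` with an action of `G` and a flow `Φ` is a flow space for the discrete group
`G` if both actions commute and the action of `G` is isometric and proper. (Together with the
continuity of `Φ`, this makes the action of `G × ℝ` continuous.) -/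
structure IsFlowSpace (G : Type*) {X : Type*} [Group G] [MetricSpace X] [MulAction G X]
    (Φ : Flow ℝ X) : Prop where
  /-- the actions of `G` and `ℝ` commute -/
  smul_flow : ∀ (g : G) (t : ℝ) (x : X), g • Φ t x = Φ t (g • x)
  /-- `G` acts by isometries -/
  isometry_smul : ∀ g : G, Isometry (fun x : X => g • x)
  /-- `G` acts properly -/
  proper : ∀ K : Set X, IsCompact K → {g : G | (K ∩ g • K).Nonempty}.Finite

variable {G X : Type*} [Group G] [MetricSpace X] [MulAction G X] {Φ : Flow ℝ X}

/-- The set of all points on compact flow lines: `x` such that `Φ_t x = x` for some `t > 0`. -/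
def periodicPoints (Φ : Flow ℝ X) : Set X :=
  {x | ∃ t : ℝ, 0 < t ∧ Φ t x = x}

/-- `c` is an axis of `g`, and `l(g, c) = t`: the point `c` is not periodic, `t > 0` and
`Φ_t c = g c`. For given `g` and `c` there is at most one such `t`. -/
def IsAxisWithLength (Φ : Flow ℝ X) (g : G) (c : X) (t : ℝ) : Prop :=
  c ∉ periodicPoints Φ ∧ 0 < t ∧ Φ t c = g • c

theorem flow_comm (Φ : Flow ℝ X) (s t : ℝ) (x : X) : Φ s (Φ t x) = Φ t (Φ s x) := by
  rw [← Φ.map_add, ← Φ.map_add, add_comm]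

theorem flow_injective (Φ : Flow ℝ X) (t : ℝ) : Function.Injective (Φ t) := by
  intro x y h
  have h2 := congrArg (Φ (-t)) h
  simpa [← Φ.map_add] using h2

theorem IsAxisWithLength.smul (hX : IsFlowSpace G Φ) {h : G} {c : X} {t : ℝ}
    (hc : IsAxisWithLength Φ h c t) (g : G) :
    IsAxisWithLength Φ (g * h * g⁻¹) (g • c) t := by
  obtain ⟨h1, h2, h3⟩ := hc
  refine ⟨?_, h2, ?_⟩
  · rintro ⟨s, hs, hs'⟩
    rw [← hX.smul_flow] at hs'
    exact h1 ⟨s, hs, MulAction.injective g hs'⟩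
  · rw [← hX.smul_flow, h3]
    simp [mul_smul]

theorem IsAxisWithLength.flow (hX : IsFlowSpace G Φ) {g : G} {c : X} {t : ℝ}
    (hc : IsAxisWithLength Φ g c t) (s : ℝ) :
    IsAxisWithLength Φ g (Φ s c) t := by
  obtain ⟨h1, h2, h3⟩ := hc
  refine ⟨?_, h2, ?_⟩
  · rintro ⟨r, hr, hr'⟩
    rw [flow_comm] at hr'
    exact h1 ⟨r, hr, flow_injective Φ s hr'⟩
  · rw [flow_comm, h3, hX.smul_flow]

/-- The `G`-space `X_axes` of all axes with `G`-period at most `γ`: the points of `X` which are an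
axis of some `g` with `l(g, x) ≤ γ`. -/
def axes (hX : IsFlowSpace G Φ) (γ : ℝ) : SubMulAction G X where
  carrier := {x | ∃ (g : G) (t : ℝ), IsAxisWithLength Φ g x t ∧ t ≤ γ}
  smul_mem' := by
    rintro g x ⟨h, t, hx, ht⟩
    exact ⟨g * h * g⁻¹, t, hx.smul hX g, ht⟩

theorem isInvariant_axes (hX : IsFlowSpace G Φ) (γ : ℝ) :
    IsInvariant Φ (axes hX γ : Set X) := by
  rintro s x ⟨g, t, hx, ht⟩
  exact ⟨g, t, hx.flow hX s, ht⟩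

/-- The restriction of the flow to `X_axes`. -/
def axesFlow (hX : IsFlowSpace G Φ) (γ : ℝ) : Flow ℝ (axes hX γ) :=
  Φ.restrict (isInvariant_axes hX γ)

end FlowSpace

namespace FlowSpace

open Set Filter Topology TopologicalSpace

/-! ### Covering dimension -/

/-! Write Y for X_axes and π : Y → Q for the quotient by G × ℝ. Points of Y have infinite
stabilizers in G × ℝ, so this action is not proper; but up to powers of an axis element every flow
time reduces to [0, γ], and over bounded times properness of G gives limits
(`IsFlowSpace.exists_limit`). Hence Y is closed in X, flow lines have virtually cyclic stabilizers H
and flow invariant neighbourhoods W that gW meets only for g in H (`exists_flowInvariant_nhds`), and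
Q is locally compact, Hausdorff and second countable, so metrizable. An open cover of Q refining the
images of the W pulls back to Y: over a member O one takes the translates of W cut down to π⁻¹(O).
These are equal or disjoint, so the dimension does not grow (`exists_flowInvariant_cover`). What
remains is dim Q ≤ dim X (`coveringDimLE_orbitSpace`). As no point of Y is periodic, the flow has
local transversals, which map openly to Q. Countably many compact pieces of Q have continuous
sections into transversals, so they embed as closed subsets of Y, and the countable closed sum
theorem (`CoveringDimLE.of_iUnion`) applies. -/

theorem collectionDim_le_natCast_iff {X : Type*} {𝒰 : Set (Set X)} {n : ℕ} :
    collectionDim 𝒰 ≤ (n : WithBot ℕ∞) ↔ ∀ x, {U ∈ 𝒰 | x ∈ U}.encard ≤ n + 1 := by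
  constructor
  · intro h x
    by_contra! hx
    have h2 : ((n + 2 : ℕ) : ℕ∞) ≤ {U ∈ 𝒰 | x ∈ U}.encard := by
      have := Order.add_one_le_of_lt hx
      refine le_trans (le_of_eq ?_) this
      push_cast
      rw [add_assoc]
      rfl
    obtain ⟨t, ht, htc⟩ := exists_subset_encard_eq h2
    have hfin : t.Finite := finite_of_encard_eq_coe htc
    obtain ⟨s, rfl⟩ := hfin.exists_finset_coe
    rw [encard_coe_eq_coe_finsetCard] at htc
    have hc : s.card = n + 2 := by exact_mod_cast htc
    have : ((s.card - 1 : ℕ) : WithBot ℕ∞) ≤ n := by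
      refine le_trans ?_ h
      refine le_iSup₂_of_le s ⟨Finset.card_pos.1 (by omega), fun U hU => (ht hU).1, x, ?_⟩ le_rfl
      simp only [mem_iInter]
      exact fun U hU => (ht hU).2
    rw [hc] at this
    have : n + 2 - 1 ≤ n := by exact_mod_cast this
    omega
  · intro h
    refine iSup₂_le ?_
    rintro s ⟨-, hs, x, hx⟩
    simp only [mem_iInter] at hx
    have h1 : (s : Set (Set X)).encard ≤ n + 1 :=
      (encard_le_encard (t := {U ∈ 𝒰 | x ∈ U}) fun U hU => ⟨hs hU, hx U hU⟩).trans (h x)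
    rw [encard_coe_eq_coe_finsetCard] at h1
    have h2 : s.card ≤ n + 1 := by exact_mod_cast h1
    have h3 : s.card - 1 ≤ n := by omega
    exact_mod_cast h3

/-- Every open cover has an open refinement which is a cover of dimension at most `n`. -/
def CoveringDimLE (X : Type*) [TopologicalSpace X] (n : WithBot ℕ∞) : Prop :=
  ∀ 𝒰 : Set (Set X), IsOpenCovering 𝒰 →
    ∃ 𝒱 : Set (Set X), IsOpenCovering 𝒱 ∧ Refines 𝒱 𝒰 ∧ collectionDim 𝒱 ≤ n

/-- The order on `WithBot ℕ∞` is well-founded, so the infimum of a nonempty set is attained; `⊤` is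
always admissible. -/
theorem coveringDimLE_coveringDim (X : Type*) [TopologicalSpace X] :
    CoveringDimLE X (coveringDim X) :=
  csInf_mem (s := {n | CoveringDimLE X n})
    ⟨⊤, fun 𝒰 h𝒰 => ⟨𝒰, h𝒰, fun U hU => ⟨U, hU, Subset.rfl⟩, le_top⟩⟩

theorem CoveringDimLE.isEmpty {X : Type*} [TopologicalSpace X] (h : CoveringDimLE X ⊥) :
    IsEmpty X := by
  refine ⟨fun x => ?_⟩
  obtain ⟨𝒱, h𝒱, -, hd⟩ := h {univ} ⟨by simp, by simp⟩
  obtain ⟨V, hV, hx⟩ : x ∈ ⋃₀ 𝒱 := h𝒱.2 ▸ mem_univ x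
  have : ((({V} : Finset (Set X)).card - 1 : ℕ) : WithBot ℕ∞) ≤ ⊥ :=
    le_trans (le_iSup₂_of_le {V} ⟨by simp, by simpa using hV, x, by simpa using hx⟩ le_rfl) hd
  simp at this

/-- Each member of a refinement is assigned to one index and members with the same index are merged;
merging cannot increase the order at a point. -/
theorem CoveringDimLE.exists_precise {X : Type*} [TopologicalSpace X] {n : ℕ}
    (h : CoveringDimLE X n) {ι : Type*} (U : ι → Set X) (hU : ∀ i, IsOpen (U i))
    (hcov : ⋃ i, U i = univ) :
    ∃ V : ι → Set X, (∀ i, IsOpen (V i)) ∧ ⋃ i, V i = univ ∧ (∀ i, V i ⊆ U i) ∧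
      ∀ x, {i | x ∈ V i}.encard ≤ n + 1 := by
  obtain ⟨𝒱, ⟨h𝒱o, h𝒱c⟩, hr, hd⟩ := h (range U) ⟨by simpa using hU, by simpa using hcov⟩
  rw [collectionDim_le_natCast_iff] at hd
  have hr' : ∀ V : 𝒱, ∃ i, V.1 ⊆ U i := fun V => by simpa using hr V V.2
  choose c hc using hr'
  refine ⟨fun i => ⋃ V : 𝒱, ⋃ _ : c V = i, V.1, fun i => ?_, ?_, fun i => ?_, fun x => ?_⟩
  · exact isOpen_iUnion fun V => isOpen_iUnion fun _ => h𝒱o V V.2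
  · refine eq_univ_of_forall fun x => ?_
    obtain ⟨V, hV, hx⟩ : x ∈ ⋃₀ 𝒱 := h𝒱c ▸ mem_univ x
    simp only [mem_iUnion]
    exact ⟨c ⟨V, hV⟩, ⟨V, hV⟩, rfl, hx⟩
  · refine iUnion₂_subset ?_
    rintro V rfl
    exact hc V
  · refine le_trans ?_ (hd x)
    have key : ∀ i : {i | x ∈ ⋃ V : 𝒱, ⋃ _ : c V = i, V.1}, ∃ V : 𝒱, c V = i ∧ x ∈ V.1 := by
      rintro ⟨i, hi⟩
      simpa using hi
    choose v hv hxv using key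
    have hinj : Function.Injective
        (fun i => (⟨(v i).1, (v i).2, hxv i⟩ : {V | V ∈ 𝒱 ∧ x ∈ V})) := by
      intro i j hij
      have : v i = v j := Subtype.ext (congrArg (fun z : {V | V ∈ 𝒱 ∧ x ∈ V} => z.1) hij)
      exact Subtype.ext ((hv i).symm.trans (this ▸ hv j))
    exact Function.Embedding.encard_le ⟨_, hinj⟩

theorem CoveringDimLE.of_precise {X : Type*} [TopologicalSpace X] {n : ℕ}
    (h : ∀ (U : Set X → Set X), (∀ i, IsOpen (U i)) → ⋃ i, U i = univ →
      ∃ V : Set X → Set X, (∀ i, IsOpen (V i)) ∧ ⋃ i, V i = univ ∧ (∀ i, V i ⊆ U i) ∧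
        ∀ x, {i | x ∈ V i}.encard ≤ n + 1) : CoveringDimLE X n := by
  classical
  intro 𝒰 h𝒰
  -- The cover indexes itself; sets outside it are padded with `∅`.
  obtain ⟨V, hVo, hVc, hVs, hVd⟩ := h (fun S => if S ∈ 𝒰 then S else ∅)
    (fun S => by split_ifs with hS <;> simp [h𝒰.1, *])
    (by
      rw [← h𝒰.2]
      ext x
      simp only [mem_iUnion, mem_sUnion]
      constructor
      · rintro ⟨S, hS⟩
        split_ifs at hS with hSU
        · exact ⟨S, hSU, hS⟩
        · exact hS.elim
      · rintro ⟨S, hSU, hS⟩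
        exact ⟨S, by rwa [if_pos hSU]⟩)
  have hV' : ∀ S ∉ 𝒰, V S = ∅ := fun S hS => by
    have := hVs S
    rwa [if_neg hS, subset_empty_iff] at this
  refine ⟨V '' 𝒰, ⟨?_, ?_⟩, ?_, ?_⟩
  · rintro _ ⟨S, -, rfl⟩
    exact hVo S
  · refine eq_univ_of_forall fun x => ?_
    obtain ⟨S, hS⟩ := mem_iUnion.1 (hVc ▸ mem_univ x)
    refine ⟨V S, ⟨S, ?_, rfl⟩, hS⟩
    by_contra hSU
    rw [hV' S hSU] at hS
    exact hS
  · rintro _ ⟨S, hS, rfl⟩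
    refine ⟨S, hS, ?_⟩
    have := hVs S
    rwa [if_pos hS] at this
  · rw [collectionDim_le_natCast_iff]
    refine fun x => le_trans ?_ (hVd x)
    refine le_trans (encard_le_encard ?_) (encard_image_le V {S | x ∈ V S})
    rintro _ ⟨⟨S, -, rfl⟩, hx⟩
    exact ⟨S, hx, rfl⟩

theorem CoveringDimLE.of_isClosedEmbedding {T X : Type*} [TopologicalSpace T] [TopologicalSpace X]
    {n : ℕ} (h : CoveringDimLE X n) {e : T → X} (he : IsClosedEmbedding e) :
    CoveringDimLE T n := by
  refine .of_precise fun U hU hcov => ?_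
  choose O hO hOU using fun i => he.isInducing.isOpen_iff.1 (hU i)
  -- The index `none` carries the complement of the closed range, which vanishes on pulling back to
  -- `T`.
  obtain ⟨V, hVo, hVc, hVs, hVd⟩ := h.exists_precise
    (fun i : Option (Set T) => i.elim (range e)ᶜ O)
    (by
      rintro (_ | i)
      · exact he.isClosed_range.isOpen_compl
      · exact hO i)
    (by
      refine eq_univ_of_forall fun x => mem_iUnion.2 ?_
      by_cases hx : x ∈ range e
      · obtain ⟨t, rfl⟩ := hx
        obtain ⟨i, hi⟩ := mem_iUnion.1 (hcov ▸ mem_univ t)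
        exact ⟨some i, by rwa [← hOU i] at hi⟩
      · exact ⟨none, hx⟩)
  refine ⟨fun i => e ⁻¹' V (some i), fun i => (hVo _).preimage he.continuous, ?_, fun i => ?_,
    fun t => ?_⟩
  · refine eq_univ_of_forall fun t => mem_iUnion.2 ?_
    obtain ⟨_ | i, hi⟩ := mem_iUnion.1 (hVc ▸ mem_univ (e t))
    · exact (hVs none hi ⟨t, rfl⟩).elim
    · exact ⟨i, hi⟩
  · rw [← hOU i]
    exact preimage_mono (hVs (some i))
  · refine le_trans ?_ (hVd (e t))
    rw [← (Option.some_injective (Set T)).encard_image]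
    refine encard_le_encard ?_
    rintro _ ⟨i, hi, rfl⟩
    exact hi

/-- A locally finite family of closed sets in a metrizable space, subordinate to a locally finite
open family, has an open swelling of the same order. -/
theorem exists_open_swelling {Z ι : Type*} [TopologicalSpace Z] [MetrizableSpace Z] {n : ℕ}
    {E U : ι → Set Z} (hE : ∀ i, IsClosed (E i)) (hU : ∀ i, IsOpen (U i)) (hlf : LocallyFinite U)
    (hEU : ∀ i, E i ⊆ U i) (hn : ∀ x, {i | x ∈ E i}.encard ≤ n + 1) :
    ∃ W : ι → Set Z, (∀ i, IsOpen (W i)) ∧ (∀ i, E i ⊆ W i) ∧ (∀ i, W i ⊆ U i) ∧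
      ∀ x, {i | x ∈ W i}.encard ≤ n + 1 := by
  let := metrizableSpaceMetric Z
  have hf : ∀ i, ∃ f : Z → ENNReal, Continuous f ∧ (∀ x, f x = 0 ↔ x ∈ E i) ∧
      (∀ x ∉ U i, f x = 1) := by
    intro i
    obtain ⟨g, hg0, hg1, hg⟩ := exists_continuous_zero_one_of_isClosed (hE i)
      (hU i).isClosed_compl (disjoint_compl_right_iff_subset.2 (hEU i))
    -- The Urysohn function gives the value 1 off `U i`; the distance term makes the zero set
    -- exactly `E i`. The cap at 1 keeps the distance from exceeding 1 off `U i`.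
    refine ⟨fun x => max (ENNReal.ofReal (g x)) (min 1 (Metric.infEDist x (E i))), ?_, ?_, ?_⟩
    · exact (ENNReal.continuous_ofReal.comp g.continuous).max
        (continuous_const.min Metric.continuous_infEDist)
    · intro x
      constructor
      · intro h
        have h1 : min 1 (Metric.infEDist x (E i)) = 0 :=
          le_antisymm (le_trans (le_max_right _ _) h.le) bot_le
        have h2 : Metric.infEDist x (E i) = 0 := by
          rcases min_choice 1 (Metric.infEDist x (E i)) with h | h
          · rw [h] at h1
            simp at h1
          · rwa [h] at h1
        rw [← (hE i).closure_eq]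
        exact Metric.mem_closure_iff_infEDist_zero.2 h2
      · intro h
        have h0 : g x = 0 := hg0 h
        simp [h0, Metric.infEDist_zero_of_mem h]
    · intro x hx
      have h1 : g x = 1 := hg1 hx
      simp [h1]
  choose f hfc hf0 hf1 using hf
  have hfU : ∀ {i x}, f i x < 1 → x ∈ U i := fun {i x} h => by
    by_contra hx
    exact h.ne (hf1 i x hx)
  -- An index is admitted at `x` only if at most `n + 1` indices have values no larger. The admitted
  -- index of largest value then bounds the number of all admitted ones.
  refine ⟨fun i => {x | f i x < 1 ∧ {k | f k x ≤ f i x}.encard ≤ n + 1}, fun i => ?_, fun i x hx => ?_,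
    fun i x hx => hfU hx.1, fun x => ?_⟩
  · rw [isOpen_iff_mem_nhds]
    rintro x ⟨hx1, hx2⟩
    obtain ⟨N, hN, hI⟩ := hlf x
    have h1 : ∀ᶠ y in 𝓝 x, f i y < 1 := (hfc i).continuousAt.eventually_lt continuousAt_const hx1
    -- By local finiteness only finitely many `k` compete near `x`, and strict inequalities persist
    -- nearby, so no new index enters the count.
    have h2 : ∀ᶠ y in 𝓝 x, ∀ k ∈ {k | (U k ∩ N).Nonempty}, f i x < f k x → f i y < f k y := by
      rw [eventually_all_finite hI]
      intro k _
      by_cases hk : f i x < f k x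
      · filter_upwards [(hfc i).continuousAt.eventually_lt (hfc k).continuousAt hk] with y hy _
        exact hy
      · exact Eventually.of_forall fun y h => (hk h).elim
    filter_upwards [h1, h2, hN] with y hy1 hy2 hyN
    refine ⟨hy1, le_trans (encard_le_encard fun k hk => ?_) hx2⟩
    by_contra hk'
    have hk1 : f k y ≤ f i y := hk
    exact (hy2 k ⟨y, hfU (hk1.trans_lt hy1), hyN⟩ (not_le.1 hk')).not_ge hk1
  · have h0 := (hf0 i x).2 hx
    refine ⟨by simp [h0], ?_⟩
    simpa only [h0, nonpos_iff_eq_zero, hf0] using hn x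
  · rcases eq_empty_or_nonempty
      {i | x ∈ {x | f i x < 1 ∧ {k | f k x ≤ f i x}.encard ≤ n + 1}} with h | h
    · rw [h]
      simp
    · obtain ⟨i, hi, hmax⟩ := exists_max_image _ (fun i => f i x)
        ((hlf.point_finite x).subset fun i hi => hfU hi.1) h
      exact le_trans (encard_le_encard fun k hk => hmax k hk) hi.2

/-- A refinement on `C` extends to open sets `O i` of `Z`. Replacing `U i` by `U i ∩ (Cᶜ ∪ O i)`
changes nothing off `C` and has the right order on `C`; normality then shrinks closures. -/
theorem exists_shrinking_of_coveringDimLE {Z ι : Type*} [TopologicalSpace Z] [NormalSpace Z] {n : ℕ}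
    {C : Set Z} (hC : IsClosed C) (hn : CoveringDimLE C n) {U : ι → Set Z}
    (hU : ∀ i, IsOpen (U i)) (hcov : ⋃ i, U i = univ) (hlf : LocallyFinite U) :
    ∃ V : ι → Set Z, (∀ i, IsOpen (V i)) ∧ ⋃ i, V i = univ ∧ (∀ i, closure (V i) ⊆ U i) ∧
      ∀ x ∈ C, {i | x ∈ V i}.encard ≤ n + 1 := by
  obtain ⟨V, hVo, hVc, hVs, hVd⟩ := hn.exists_precise (fun i => ((↑) : C → Z) ⁻¹' U i)
    (fun i => (hU i).preimage continuous_subtype_val) (by rw [← preimage_iUnion, hcov, preimage_univ])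
  choose O hO hOV using fun i => isOpen_induced_iff.1 (hVo i)
  have hmem : ∀ i (x : C), x ∈ V i ↔ x.1 ∈ O i := fun i x => by rw [← hOV i, mem_preimage]
  obtain ⟨W, hWc, hWo, hWs⟩ := exists_iUnion_eq_closure_subset
    (u := fun i => U i ∩ (Cᶜ ∪ O i)) (fun i => (hU i).inter (hC.isOpen_compl.union (hO i)))
    (fun x => (hlf.point_finite x).subset fun i hi => hi.1)
    (by
      refine eq_univ_of_forall fun x => mem_iUnion.2 ?_
      by_cases hx : x ∈ C
      · obtain ⟨i, hi⟩ := mem_iUnion.1 (hVc ▸ mem_univ (⟨x, hx⟩ : C))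
        exact ⟨i, hVs i hi, Or.inr ((hmem i ⟨x, hx⟩).1 hi)⟩
      · obtain ⟨i, hi⟩ := mem_iUnion.1 (hcov ▸ mem_univ x)
        exact ⟨i, hi, Or.inl hx⟩)
  refine ⟨W, hWo, hWc, fun i => (hWs i).trans inter_subset_left, fun x hx => ?_⟩
  refine le_trans (encard_le_encard fun i hi => ?_) (hVd ⟨x, hx⟩)
  exact (hmem i ⟨x, hx⟩).2 ((hWs i (subset_closure hi)).2.resolve_left fun h => h hx)

/-- Successive shrinkings, the `j`-th correcting the order on `C j`, are nested with closures. Their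
intersections form a closed cover of the right order everywhere, which is swollen back to an open
one. -/
theorem CoveringDimLE.of_iUnion_nat {Z : Type*} [TopologicalSpace Z] [MetrizableSpace Z] {n : ℕ}
    (C : ℕ → Set Z) (hC : ∀ j, IsClosed (C j)) (hcov : ⋃ j, C j = univ)
    (hn : ∀ j, CoveringDimLE (C j) n) : CoveringDimLE Z n := by
  let := metrizableSpaceMetric Z
  refine .of_precise fun U₀ hU₀ hU₀c => ?_
  obtain ⟨U, hUo, hUc, hUlf, hUs⟩ := precise_refinement U₀ hU₀ hU₀c
  let P : (Set Z → Set Z) → Prop := fun V => (∀ i, IsOpen (V i)) ∧ ⋃ i, V i = univ ∧ LocallyFinite V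
  have step : ∀ (j : ℕ) (V : {V // P V}), ∃ V' : {V // P V}, (∀ i, closure (V'.1 i) ⊆ V.1 i) ∧
      ∀ x ∈ C j, {i | x ∈ V'.1 i}.encard ≤ n + 1 := by
    rintro j ⟨V, hV1, hV2, hV3⟩
    obtain ⟨V', h1, h2, h3, h4⟩ := exists_shrinking_of_coveringDimLE (hC j) (hn j) hV1 hV2 hV3
    exact ⟨⟨V', h1, h2, hV3.subset fun i => subset_closure.trans (h3 i)⟩, h3, h4⟩
  choose F hF hFd using step
  let S : ℕ → {V // P V} := fun j => Nat.rec ⟨U, hUo, hUc, hUlf⟩ F j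
  have hS : ∀ j i, closure ((S (j + 1)).1 i) ⊆ (S j).1 i := fun j => hF j (S j)
  have hanti : ∀ i, Antitone fun j => (S j).1 i := fun i =>
    antitone_nat_of_succ_le fun j => subset_closure.trans (hS j i)
  obtain ⟨W, hWo, hWE, hWU, hWd⟩ := exists_open_swelling (n := n)
    (E := fun i => ⋂ j, closure ((S j).1 i)) (U := U) (fun i => isClosed_iInter fun j => isClosed_closure)
    hUo hUlf (fun i => (iInter_subset _ 1).trans (hS 0 i)) (fun x => by
      obtain ⟨j, hj⟩ := mem_iUnion.1 (hcov ▸ mem_univ x)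
      -- Stage `j + 1` is the one controlled on `C j`, and it contains the closure of stage `j + 2`.
      refine le_trans (encard_le_encard fun i hi => ?_) (hFd j (S j) x hj)
      exact hS (j + 1) i (mem_iInter.1 hi (j + 2)))
  refine ⟨W, hWo, ?_, fun i => (hWU i).trans (hUs i), hWd⟩
  refine eq_univ_of_forall fun x => mem_iUnion.2 ?_
  suffices h : ∃ i, ∀ j, x ∈ (S j).1 i by
    obtain ⟨i, hi⟩ := h
    exact ⟨i, hWE i (mem_iInter.2 fun j => subset_closure (hi j))⟩
  -- Pigeonhole: finitely many indices serve all stages at `x`, so one serves infinitely many, hence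
  -- all by monotonicity.
  have hfin : Finite {i | x ∈ U i} := (hUlf.point_finite x).to_subtype
  have hex : ∀ j, ∃ i : {i | x ∈ U i}, x ∈ (S j).1 i := fun j => by
    obtain ⟨i, hi⟩ := mem_iUnion.1 ((S j).2.2.1 ▸ mem_univ x)
    exact ⟨⟨i, hanti i (Nat.zero_le j) hi⟩, hi⟩
  choose c hc using hex
  obtain ⟨i, hi⟩ := Finite.exists_infinite_fiber c
  refine ⟨i, fun j => ?_⟩
  obtain ⟨k, hk, hjk⟩ := (infinite_coe_iff.1 hi).exists_gt j
  have h := hc k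
  rw [mem_preimage, mem_singleton_iff] at hk
  rw [hk] at h
  exact hanti i hjk.le h

/-- The countable closed sum theorem. -/
theorem CoveringDimLE.of_iUnion {Z κ : Type*} [TopologicalSpace Z] [MetrizableSpace Z] [Countable κ]
    {n : ℕ} (C : κ → Set Z) (hC : ∀ j, IsClosed (C j)) (hcov : ⋃ j, C j = univ)
    (hn : ∀ j, CoveringDimLE (C j) n) : CoveringDimLE Z n := by
  rcases isEmpty_or_nonempty κ with h | h
  · have : IsEmpty Z := by
      rw [iUnion_of_empty] at hcov
      exact univ_eq_empty_iff.1 hcov.symm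
    exact .of_iUnion_nat (fun _ => univ) (fun _ => isClosed_univ) (eq_univ_of_forall isEmptyElim)
      fun _ 𝒰 _ => ⟨∅, ⟨by simp, eq_univ_of_forall fun x => isEmptyElim x.1⟩, by simp [Refines],
        collectionDim_le_natCast_iff.2 fun x => isEmptyElim x.1⟩
  · obtain ⟨s, hs⟩ := exists_surjective_nat κ
    exact .of_iUnion_nat (C ∘ s) (fun j => hC _) (by rw [← hcov, ← hs.iUnion_comp]; rfl) fun j => hn _

/-! ### Orbits of axes -/

section Axes

variable {G X : Type*} [Group G] [MetricSpace X] [MulAction G X] {Φ : Flow ℝ X}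

theorem flow_neg_flow (Φ : Flow ℝ X) (t : ℝ) (x : X) : Φ (-t) (Φ t x) = x := by
  rw [← Φ.map_add, neg_add_cancel, Φ.map_zero_apply]

theorem continuous_flow (Φ : Flow ℝ X) (t : ℝ) : Continuous (Φ t) := Φ.continuous_toFun t

theorem continuous_flow_uncurry (Φ : Flow ℝ X) : Continuous fun p : ℝ × X => Φ p.1 p.2 :=
  Φ.continuous continuous_fst continuous_snd

theorem IsFlowSpace.continuous_smul (hX : IsFlowSpace G Φ) (g : G) :
    Continuous fun x : X => g • x := (hX.isometry_smul g).continuous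

theorem IsFlowSpace.pow_smul (hX : IsFlowSpace G Φ) {g : G} {x : X} {τ : ℝ} (h : Φ τ x = g • x)
    (n : ℕ) : g ^ n • x = Φ (n * τ) x := by
  induction n with
  | zero => simp
  | succ n ih =>
    rw [pow_succ, mul_smul, ← h, hX.smul_flow, ih, ← Φ.map_add]
    congr 1
    push_cast
    ring

theorem IsFlowSpace.zpow_smul (hX : IsFlowSpace G Φ) {g : G} {x : X} {τ : ℝ} (h : Φ τ x = g • x)
    (m : ℤ) : g ^ m • x = Φ (m * τ) x := by
  obtain ⟨n, rfl | rfl⟩ := m.eq_nat_or_neg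
  · simpa using hX.pow_smul h n
  · rw [zpow_neg, inv_smul_eq_iff, hX.smul_flow, zpow_natCast, hX.pow_smul h n]
    push_cast
    rw [neg_mul, flow_neg_flow]

/-- Along an axis of `g`, the flow for arbitrary time agrees up to powers of `g` with the flow for
a time in one period. -/
theorem IsFlowSpace.exists_flow_eq (hX : IsFlowSpace G Φ) {g : G} {x : X} {τ : ℝ} (hτ : 0 < τ)
    (h : Φ τ x = g • x) (t : ℝ) : ∃ m : ℤ, ∃ r ∈ Icc 0 τ, Φ t x = g ^ m • Φ r x := by
  refine ⟨⌊t / τ⌋, t - ⌊t / τ⌋ * τ, ⟨?_, ?_⟩, ?_⟩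
  · have := Int.floor_le (t / τ)
    rw [le_div_iff₀ hτ] at this
    linarith
  · have := Int.lt_floor_add_one (t / τ)
    rw [div_lt_iff₀ hτ] at this
    linarith
  · rw [hX.smul_flow, hX.zpow_smul h, ← Φ.map_add, sub_add_cancel]

/-- Properness of the action of `G × ℝ` over bounded time intervals. -/
theorem IsFlowSpace.exists_limit [LocallyCompactSpace X] (hX : IsFlowSpace G Φ) {α : Type*}
    {l : Ultrafilter α} {x x' : α → X} {y y' : X} {t : α → ℝ} {g : α → G} {a b : ℝ}
    (hx : Tendsto x l (𝓝 y)) (hx' : Tendsto x' l (𝓝 y')) (ht : ∀ᶠ i in (l : Filter α), t i ∈ Icc a b)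
    (h : ∀ᶠ i in (l : Filter α), g i • Φ (t i) (x i) = x' i) :
    ∃ g₀ : G, ∃ t₀ ∈ Icc a b, (∀ᶠ i in (l : Filter α), g i = g₀) ∧ Tendsto t l (𝓝 t₀) ∧
      g₀ • Φ t₀ y = y' := by
  obtain ⟨K, hK, hKy⟩ := exists_compact_mem_nhds y
  obtain ⟨K', hK', hKy'⟩ := exists_compact_mem_nhds y'
  -- This compact set contains both `Φ (t i) (x i)` and its translate `x' i`, so `g i` takes
  -- finitely many values and is constant along the ultrafilter.
  have hL : IsCompact ((fun p : ℝ × X => Φ p.1 p.2) '' (Icc a b ×ˢ K) ∪ K') :=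
    ((isCompact_Icc.prod hK).image (continuous_flow_uncurry Φ)).union hK'
  have hg : ∀ᶠ i in (l : Filter α), ∃ g₀ ∈ {g : G | (((fun p : ℝ × X => Φ p.1 p.2) ''
      (Icc a b ×ˢ K) ∪ K') ∩ g • ((fun p : ℝ × X => Φ p.1 p.2) '' (Icc a b ×ˢ K) ∪ K')).Nonempty},
      g i = g₀ := by
    filter_upwards [h, ht, hx hKy, hx' hKy'] with i h1 h2 h3 h4
    refine ⟨g i, ⟨x' i, Or.inr h4, ?_⟩, rfl⟩
    rw [← h1]
    exact smul_mem_smul_set (Or.inl ⟨(t i, x i), ⟨h2, h3⟩, rfl⟩)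
  obtain ⟨g₀, -, hg₀⟩ := (Ultrafilter.eventually_exists_mem_iff (hX.proper _ hL)).1 hg
  obtain ⟨t₀, ht₀, hlim⟩ := isCompact_Icc.ultrafilter_le_nhds' (l.map t) ht
  refine ⟨g₀, t₀, ht₀, hg₀, hlim, ?_⟩
  have h1 : Tendsto (fun i => g₀ • Φ (t i) (x i)) l (𝓝 (g₀ • Φ t₀ y)) :=
    ((hX.continuous_smul g₀).tendsto _).comp
      (((continuous_flow_uncurry Φ).tendsto (t₀, y)).comp (Tendsto.prodMk_nhds hlim hx))
  refine tendsto_nhds_unique_of_eventuallyEq h1 hx' ?_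
  filter_upwards [h, hg₀] with i h2 h3
  rw [← h2, h3]

theorem IsAxisWithLength.pow_ne_one (hX : IsFlowSpace G Φ) {g : G} {x : X} {t : ℝ}
    (h : IsAxisWithLength Φ g x t) {n : ℕ} (hn : n ≠ 0) : g ^ n ≠ 1 := by
  intro h1
  refine h.1 ⟨n * t, mul_pos (by positivity) h.2.1, ?_⟩
  rw [← hX.pow_smul h.2.2, h1, one_smul]

/-- The bound `γ` lets axis elements and lengths converge, giving `Φ t₀ x = g x` in the limit. Since
`g` also has an axis nearby, it has infinite order, and properness excludes degeneration of the
limit. -/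
theorem isClosed_axes [LocallyCompactSpace X] (hX : IsFlowSpace G Φ) (γ : ℝ) :
    IsClosed (axes hX γ : Set X) := by
  rw [isClosed_iff_ultrafilter]
  intro x u hu hmem
  have key : ∀ z : X, ∃ (g : G) (t : ℝ), z ∈ (axes hX γ : Set X) → IsAxisWithLength Φ g z t ∧ t ≤ γ := by
    intro z
    by_cases hz : z ∈ (axes hX γ : Set X)
    · obtain ⟨g, t, h⟩ := hz
      exact ⟨g, t, fun _ => h⟩
    · exact ⟨1, 0, fun h => (hz h).elim⟩
  choose g t hgt using key
  have hid : Tendsto id (u : Filter X) (𝓝 x) := hu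
  obtain ⟨g₀, t₀, ht₀, hg₀, -, hx⟩ := hX.exists_limit (g := fun z => (g z)⁻¹) (t := t) (a := 0) (b := γ)
    hid hid
    (by filter_upwards [hmem] with z hz using ⟨(hgt z hz).1.2.1.le, (hgt z hz).2⟩)
    (by filter_upwards [hmem] with z hz using by simp [(hgt z hz).1.2.2])
  obtain ⟨z, hz, hzm⟩ := (hg₀.and hmem).exists
  have hax := (hgt z hzm).1
  rw [← hz, inv_smul_eq_iff] at hx
  have hinj : Function.Injective fun n : ℕ => g z ^ n := injective_pow_iff_not_isOfFinOrder.2 (by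
    rw [isOfFinOrder_iff_pow_eq_one]
    rintro ⟨n, hn, h1⟩
    exact hax.pow_ne_one hX hn.ne' h1)
  -- If all `g ^ n x` stayed in a compact flow segment, infinitely many powers would violate
  -- properness. This rules out both periodicity of `x` and `t₀ = 0`.
  have hnot : ∀ s : ℝ, ¬ ∀ n : ℕ, Φ (n * t₀) x ∈ (fun r => Φ r x) '' Icc 0 s := by
    intro s hs
    have hK : IsCompact ((fun r => Φ r x) '' Icc 0 s) :=
      isCompact_Icc.image (Φ.continuous continuous_id continuous_const)
    refine infinite_range_of_injective hinj ((hX.proper _ hK).subset ?_)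
    rintro _ ⟨n, rfl⟩
    refine ⟨Φ (n * t₀) x, hs n, ?_⟩
    rw [← hX.pow_smul hx]
    refine smul_mem_smul_set ?_
    simpa using hs 0
  refine ⟨g z, t₀, ⟨?_, lt_of_le_of_ne ht₀.1 ?_, hx⟩, ht₀.2⟩
  · rintro ⟨s, hs, hs'⟩
    refine hnot s fun n => ?_
    have h1 : Φ s x = (1 : G) • x := by rw [hs', one_smul]
    obtain ⟨m, r, hr, h⟩ := hX.exists_flow_eq hs h1 (n * t₀)
    exact ⟨r, hr, by simp [h]⟩
  · rintro rfl
    exact hnot 0 fun n => ⟨0, by simp, by simp⟩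

theorem isFlowSpace_axesFlow (hX : IsFlowSpace G Φ) (γ : ℝ) :
    IsFlowSpace G (axesFlow hX γ) where
  smul_flow g t x := Subtype.ext (hX.smul_flow g t x)
  isometry_smul g := Isometry.of_dist_eq fun x y => (hX.isometry_smul g).dist_eq x.1 y.1
  proper K hK := by
    refine (hX.proper _ (hK.image continuous_subtype_val)).subset ?_
    rintro g ⟨x, hx, y, hy, rfl⟩
    exact ⟨_, ⟨_, hx, rfl⟩, ⟨y.1, ⟨y, hy, rfl⟩, rfl⟩⟩

theorem exists_isAxisWithLength_axesFlow (hX : IsFlowSpace G Φ) (γ : ℝ) (x : axes hX γ) :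
    ∃ (g : G) (t : ℝ), IsAxisWithLength (axesFlow hX γ) g x t ∧ t ≤ γ := by
  obtain ⟨g, t, ⟨h1, h2, h3⟩, h4⟩ := x.2
  refine ⟨g, t, ⟨?_, h2, Subtype.ext h3⟩, h4⟩
  rintro ⟨s, hs, hs'⟩
  exact h1 ⟨s, hs, congrArg Subtype.val hs'⟩

/-- The stabilizer in `G` of the flow line through `x`. -/
def flowLineStabilizer (hX : IsFlowSpace G Φ) (x : X) : Subgroup G where
  carrier := {g | ∃ t : ℝ, g • x = Φ t x}
  one_mem' := ⟨0, by simp⟩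
  mul_mem' := by
    rintro g h ⟨s, hs⟩ ⟨t, ht⟩
    exact ⟨t + s, by rw [mul_smul, ht, hX.smul_flow, hs, Φ.map_add]⟩
  inv_mem' := by
    rintro g ⟨t, ht⟩
    exact ⟨-t, by rw [inv_smul_eq_iff, hX.smul_flow, ht, flow_neg_flow]⟩

/-- Modulo powers of `g`, every element of the stabilizer moves `x` by a time in `[0, τ]`;
properness leaves finitely many such elements. -/
theorem isVirtuallyCyclic_flowLineStabilizer (hX : IsFlowSpace G Φ) {g : G} {x : X} {τ : ℝ}
    (h : IsAxisWithLength Φ g x τ) : IsVirtuallyCyclic (flowLineStabilizer hX x) := by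
  let g' : flowLineStabilizer hX x := ⟨g, τ, h.2.2.symm⟩
  refine ⟨Subgroup.zpowers g', inferInstance, ?_⟩
  have hK : IsCompact ((fun r => Φ r x) '' Icc 0 τ) :=
    isCompact_Icc.image (Φ.continuous continuous_id continuous_const)
  have hF : {f : flowLineStabilizer hX x | ∃ r ∈ Icc 0 τ, f.1 • x = Φ r x}.Finite := by
    refine Set.Finite.preimage (f := ((↑) : flowLineStabilizer hX x → G))
      Subtype.val_injective.injOn (hX.proper _ hK) |>.subset ?_
    rintro f ⟨r, hr, hf⟩
    refine ⟨Φ r x, ⟨r, hr, rfl⟩, ?_⟩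
    rw [← hf]
    exact smul_mem_smul_set ⟨0, ⟨le_rfl, h.2.1.le⟩, by simp⟩
  have : Finite (flowLineStabilizer hX x ⧸ Subgroup.zpowers g') := by
    have := hF.to_subtype
    refine Finite.of_surjective
      (fun f : {f : flowLineStabilizer hX x | ∃ r ∈ Icc 0 τ, f.1 • x = Φ r x} =>
        (f.1 : flowLineStabilizer hX x ⧸ Subgroup.zpowers g')) ?_
    intro q
    obtain ⟨f, rfl⟩ := QuotientGroup.mk_surjective q
    obtain ⟨t, ht⟩ := f.2
    obtain ⟨m, r, hr, hm⟩ := hX.exists_flow_eq h.2.1 h.2.2 t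
    refine ⟨⟨f * g' ^ (-m), r, hr, ?_⟩, ?_⟩
    · have h1 : ((f * g' ^ (-m) : flowLineStabilizer hX x) : G) = f.1 * g ^ (-m) := by
        simp [g']
      rw [h1, mul_smul, hX.zpow_smul h.2.2, hX.smul_flow, ht, hm, hX.smul_flow, hX.zpow_smul h.2.2,
        flow_comm, ← Φ.map_add, ← Φ.map_add]
      congr 1
      push_cast
      ring
    · refine (QuotientGroup.eq.2 ?_).symm
      simp
  exact Subgroup.finiteIndex_of_finite_quotient

end Axes

/-! ### The orbit space of a flow space consisting of axes -/

section OrbitSpace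

variable {G Y : Type*} [Group G] [MetricSpace Y] [MulAction G Y] {Φ : Flow ℝ Y}

/-- The orbit relation of the action of `G × ℝ`. -/
def orbitSetoid (hY : IsFlowSpace G Φ) : Setoid Y where
  r x y := ∃ (g : G) (t : ℝ), g • Φ t x = y
  iseqv :=
    { refl := fun x => ⟨1, 0, by simp⟩
      symm := by
        rintro x _ ⟨g, t, rfl⟩
        exact ⟨g⁻¹, -t, by rw [← hY.smul_flow, inv_smul_smul, flow_neg_flow]⟩
      trans := by
        rintro x _ _ ⟨g, t, rfl⟩ ⟨h, s, rfl⟩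
        exact ⟨h * g, s + t, by rw [← hY.smul_flow, mul_smul, Φ.map_add]⟩ }

/-- The quotient of a flow space by the action of `G × ℝ`. -/
def OrbitSpace (hY : IsFlowSpace G Φ) : Type _ := Quotient (orbitSetoid hY)

instance (hY : IsFlowSpace G Φ) : TopologicalSpace (OrbitSpace hY) :=
  inferInstanceAs (TopologicalSpace (Quotient (orbitSetoid hY)))

/-- The projection onto the orbit space. -/
def orbitMk (hY : IsFlowSpace G Φ) (y : Y) : OrbitSpace hY := Quotient.mk (orbitSetoid hY) y

variable {hY : IsFlowSpace G Φ}

theorem orbitMk_eq_iff {x y : Y} :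
    orbitMk hY x = orbitMk hY y ↔ ∃ (g : G) (t : ℝ), g • Φ t x = y := Quotient.eq (r := orbitSetoid hY)

theorem orbitMk_smul (g : G) (x : Y) : orbitMk hY (g • x) = orbitMk hY x :=
  (orbitMk_eq_iff.2 ⟨g, 0, by simp⟩).symm

theorem orbitMk_flow (t : ℝ) (x : Y) : orbitMk hY (Φ t x) = orbitMk hY x :=
  (orbitMk_eq_iff.2 ⟨1, t, by simp⟩).symm

theorem isOpenQuotientMap_orbitMk (hY : IsFlowSpace G Φ) : IsOpenQuotientMap (orbitMk hY) where
  surjective := Quotient.mk_surjective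
  continuous := continuous_quot_mk
  isOpenMap U hU := by
    have : orbitMk hY ⁻¹' (orbitMk hY '' U) =
        ⋃ (g : G) (t : ℝ), (fun x => g • Φ t x) ⁻¹' U := by
      ext x
      simp only [mem_preimage, mem_image, mem_iUnion]
      constructor
      · rintro ⟨y, hy, h⟩
        obtain ⟨g, t, rfl⟩ := orbitMk_eq_iff.1 h.symm
        exact ⟨g, t, hy⟩
      · rintro ⟨g, t, h⟩
        exact ⟨_, h, by rw [orbitMk_smul, orbitMk_flow]⟩
    rw [← (show IsQuotientMap (orbitMk hY) from isQuotientMap_quot_mk).isOpen_preimage, this]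
    exact isOpen_iUnion fun g => isOpen_iUnion fun t =>
      hU.preimage ((hY.continuous_smul g).comp (continuous_flow Φ t))

instance [SecondCountableTopology Y] : SecondCountableTopology (OrbitSpace hY) :=
  (isOpenQuotientMap_orbitMk hY).isQuotientMap.secondCountableTopology
    (isOpenQuotientMap_orbitMk hY).isOpenMap

instance [LocallyCompactSpace Y] : LocallyCompactSpace (OrbitSpace hY) :=
  (isOpenQuotientMap_orbitMk hY).locallyCompactSpace

variable {γ : ℝ}

theorem exists_bounded_of_orbit (hax : ∀ y, ∃ (g : G) (t : ℝ), IsAxisWithLength Φ g y t ∧ t ≤ γ)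
    (hY : IsFlowSpace G Φ) (x : Y) (t : ℝ) :
    ∃ (k : G) (m : ℤ), ∃ r ∈ Icc 0 γ, (∃ τ ∈ Icc 0 γ, Φ τ x = k • x) ∧ Φ t x = k ^ m • Φ r x := by
  obtain ⟨k, τ, h, hτ⟩ := hax x
  obtain ⟨m, r, hr, hm⟩ := hY.exists_flow_eq h.2.1 h.2.2 t
  exact ⟨k, m, r, ⟨hr.1, hr.2.trans hτ⟩, ⟨τ, ⟨h.2.1.le, hτ⟩, h.2.2⟩, hm⟩

/-- The orbit relation is closed: times can be reduced to `[0, γ]`, where `IsFlowSpace.exists_limit`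
applies. -/
theorem t2Space_orbitSpace [LocallyCompactSpace Y]
    (hax : ∀ y, ∃ (g : G) (t : ℝ), IsAxisWithLength Φ g y t ∧ t ≤ γ) (hY : IsFlowSpace G Φ) :
    T2Space (OrbitSpace hY) := by
  rw [t2Space_iff_of_isOpenQuotientMap (isOpenQuotientMap_orbitMk hY), isClosed_iff_ultrafilter]
  intro x u hu hmem
  have key : ∀ q : Y × Y, ∃ (g : G) (t : ℝ), orbitMk hY q.1 = orbitMk hY q.2 →
      t ∈ Icc 0 γ ∧ g • Φ t q.1 = q.2 := by
    intro q
    by_cases hq : orbitMk hY q.1 = orbitMk hY q.2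
    · obtain ⟨g, t, h⟩ := orbitMk_eq_iff.1 hq
      obtain ⟨k, m, r, hr, -, hm⟩ := exists_bounded_of_orbit hax hY q.1 t
      exact ⟨g * k ^ m, r, fun _ => ⟨hr, by rw [mul_smul, ← hm, h]⟩⟩
    · exact ⟨1, 0, fun h => (hq h).elim⟩
  choose g t hgt using key
  obtain ⟨g₀, t₀, -, -, -, h⟩ := hY.exists_limit (l := u) (x := Prod.fst) (x' := Prod.snd)
    (t := t) (g := g)
    ((continuous_fst.tendsto x).mono_left hu) ((continuous_snd.tendsto x).mono_left hu)
    (by filter_upwards [hmem] with q hq using (hgt q hq).1)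
    (by filter_upwards [hmem] with q hq using (hgt q hq).2)
  exact orbitMk_eq_iff.2 ⟨g₀, t₀, h⟩

/-- The time `t` is unbounded, so no limit of `g` itself is available. But `f = g * k ^ m` and the
axis element `k` both act with times in `[0, γ]`, so near `y` both stabilize its flow line, and
hence so does `g`. -/
theorem eventually_mem_flowLineStabilizer [LocallyCompactSpace Y]
    (hax : ∀ y, ∃ (g : G) (t : ℝ), IsAxisWithLength Φ g y t ∧ t ≤ γ) (hY : IsFlowSpace G Φ) (y : Y) :
    ∀ᶠ q : Y × Y in 𝓝 (y, y), ∀ (g : G) (t : ℝ), g • Φ t q.1 = q.2 → g ∈ flowLineStabilizer hY y := by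
  by_contra hcon
  rw [not_eventually, frequently_iff_neBot] at hcon
  obtain ⟨u, hu⟩ := Ultrafilter.exists_le (𝓝 (y, y) ⊓ 𝓟 {q : Y × Y | ¬ ∀ (g : G) (t : ℝ),
    g • Φ t q.1 = q.2 → g ∈ flowLineStabilizer hY y})
  have hu1 : (u : Filter (Y × Y)) ≤ 𝓝 (y, y) := hu.trans inf_le_left
  have hu2 := le_principal_iff.1 (hu.trans inf_le_right)
  have key : ∀ q : Y × Y, ∃ (g k f : G) (r τ : ℝ) (m : ℤ), (¬ ∀ (g : G) (t : ℝ),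
      g • Φ t q.1 = q.2 → g ∈ flowLineStabilizer hY y) → g ∉ flowLineStabilizer hY y ∧
      f = g * k ^ m ∧ r ∈ Icc 0 γ ∧ τ ∈ Icc 0 γ ∧ k⁻¹ • Φ τ q.1 = q.1 ∧ f • Φ r q.1 = q.2 := by
    intro q
    by_cases hq : ∀ (g : G) (t : ℝ), g • Φ t q.1 = q.2 → g ∈ flowLineStabilizer hY y
    · exact ⟨1, 1, 1, 0, 0, 0, fun h => (h hq).elim⟩
    · push Not at hq
      obtain ⟨g, t, h, hg⟩ := hq
      obtain ⟨k, m, r, hr, ⟨τ, hτ, hk⟩, hm⟩ := exists_bounded_of_orbit hax hY q.1 t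
      exact ⟨g, k, g * k ^ m, r, τ, m, fun _ => ⟨hg, rfl, hr, hτ, by rw [hk, inv_smul_smul],
        by rw [mul_smul, ← hm, h]⟩⟩
  choose g k f r τ m hq using key
  have h1 : Tendsto Prod.fst (u : Filter (Y × Y)) (𝓝 y) := (continuous_fst.tendsto (y, y)).mono_left hu1
  have h2 : Tendsto Prod.snd (u : Filter (Y × Y)) (𝓝 y) := (continuous_snd.tendsto (y, y)).mono_left hu1
  obtain ⟨k₀, τ₀, -, hk₀, -, hk⟩ := hY.exists_limit (t := τ) (g := fun q => (k q)⁻¹) h1 h1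
    (by filter_upwards [hu2] with q h using (hq q h).2.2.2.1)
    (by filter_upwards [hu2] with q h using (hq q h).2.2.2.2.1)
  obtain ⟨f₀, r₀, -, hf₀, -, hf⟩ := hY.exists_limit (t := r) (g := f) h1 h2
    (by filter_upwards [hu2] with q h using (hq q h).2.2.1)
    (by filter_upwards [hu2] with q h using (hq q h).2.2.2.2.2)
  obtain ⟨q, hqu, hqk, hqf⟩ := (Eventually.and hu2 (hk₀.and hf₀)).exists
  have hkm : k q ∈ flowLineStabilizer hY y := by
    refine ⟨τ₀, ?_⟩
    rw [← hqk, inv_smul_eq_iff] at hk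
    exact hk.symm
  have hfm : f q ∈ flowLineStabilizer hY y := by
    refine ⟨-r₀, ?_⟩
    rw [hqf, ← flow_neg_flow Φ r₀ (f₀ • y), ← hY.smul_flow, hf]
  refine (hq q hqu).1 ?_
  rw [(hq q hqu).2.1] at hfm
  exact (Subgroup.mul_mem_cancel_right _ (Subgroup.zpow_mem _ hkm _)).1 hfm

/-- Flow lines of axes have flow invariant open neighbourhoods which are `VCyc`-subsets with the
same stabilizer. -/
theorem exists_flowInvariant_nhds [LocallyCompactSpace Y]
    (hax : ∀ y, ∃ (g : G) (t : ℝ), IsAxisWithLength Φ g y t ∧ t ≤ γ) (hY : IsFlowSpace G Φ) (y : Y) :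
    ∃ (W : Set Y) (H : Subgroup G), IsOpen W ∧ y ∈ W ∧ IsInvariant Φ W ∧ IsVirtuallyCyclic H ∧
      (∀ g : G, (g • W ∩ W).Nonempty → g ∈ H) ∧ ∀ g ∈ H, g • W = W := by
  obtain ⟨U, hU, hyU, hUH⟩ : ∃ U : Set Y, IsOpen U ∧ y ∈ U ∧ ∀ x ∈ U, ∀ x' ∈ U, ∀ (g : G) (t : ℝ),
      g • Φ t x = x' → g ∈ flowLineStabilizer hY y := by
    have h := eventually_mem_flowLineStabilizer hax hY y
    rw [nhds_prod_eq] at h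
    obtain ⟨s, hs, h⟩ := (eventually_prod_self_iff (r := fun x x' => ∀ (g : G) (t : ℝ),
      g • Φ t x = x' → g ∈ flowLineStabilizer hY y)).1 h
    obtain ⟨U, hUs, hU, hy⟩ := mem_nhds_iff.1 hs
    exact ⟨U, hU, hy, fun x hx x' hx' => h x (hUs hx) x' (hUs hx')⟩
  -- `W` is the saturation of `U` under the flow and the stabilizer.
  refine ⟨{x | ∃ h ∈ flowLineStabilizer hY y, ∃ t : ℝ, h • Φ t x ∈ U}, flowLineStabilizer hY y,
    ?_, ⟨1, one_mem _, 0, by simpa using hyU⟩, ?_, ?_, ?_, ?_⟩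
  · have : {x | ∃ h ∈ flowLineStabilizer hY y, ∃ t : ℝ, h • Φ t x ∈ U} =
        ⋃ h ∈ flowLineStabilizer hY y, ⋃ t : ℝ, (fun x => h • Φ t x) ⁻¹' U := by
      ext x
      simp
    rw [this]
    exact isOpen_biUnion fun h _ => isOpen_iUnion fun t =>
      hU.preimage ((hY.continuous_smul h).comp (continuous_flow Φ t))
  · rintro s x ⟨h, hh, t, hx⟩
    refine ⟨h, hh, t - s, ?_⟩
    rwa [← Φ.map_add, sub_add_cancel]
  · obtain ⟨g, t, h, -⟩ := hax y
    exact isVirtuallyCyclic_flowLineStabilizer hY h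
  · rintro g ⟨_, ⟨w, ⟨h, hh, t, hw⟩, rfl⟩, h', hh', s, hw'⟩
    have h1 := hUH _ hw _ hw' (h' * g * h⁻¹) (s - t) (by
      simp only [mul_smul, ← hY.smul_flow, inv_smul_smul]
      rw [← Φ.map_add, sub_add_cancel])
    rwa [Subgroup.mul_mem_cancel_right _ (inv_mem hh), Subgroup.mul_mem_cancel_left _ hh'] at h1
  · intro g hg
    ext x
    rw [mem_smul_set_iff_inv_smul_mem]
    constructor
    · rintro ⟨h, hh, t, hx⟩
      exact ⟨h * g⁻¹, mul_mem hh (inv_mem hg), t, by rwa [mul_smul, hY.smul_flow g⁻¹]⟩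
    · rintro ⟨h, hh, t, hx⟩
      exact ⟨h * g, mul_mem hh hg, t, by rwa [mul_smul, hY.smul_flow g, smul_inv_smul]⟩

end OrbitSpace

/-! ### Transversals of flows -/

section Transversal

variable {Y : Type*} [MetricSpace Y]

/-- Near a point which is moved by the flow there is a continuous function which is strictly
increasing along flow lines. -/
theorem exists_increasing_along_flow (Φ : Flow ℝ Y) {y : Y} (hy : Φ 1 y ≠ y) :
    ∃ (h : Y → ℝ) (U : Set Y), Continuous h ∧ IsOpen U ∧ y ∈ U ∧
      ∀ (x : Y) (a b : ℝ), a < b → (∀ t ∈ Icc a b, Φ t x ∈ U) → h (Φ a x) < h (Φ b x) := by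
  have hdist : ∀ x, Continuous fun s : ℝ => dist (Φ s x) y := fun x =>
    (Φ.continuous continuous_id continuous_const).dist continuous_const
  -- The distance to `y` averaged over unit flow time: its derivative along the flow is `dist (Φ 1
  -- x) y - dist x y`, positive on `U`.
  refine ⟨fun x => ∫ s in (0 : ℝ)..1, dist (Φ s x) y, {x | dist x y < dist (Φ 1 x) y}, ?_, ?_, ?_, ?_⟩
  · refine intervalIntegral.continuous_parametric_intervalIntegral_of_continuous' ?_ 0 1
    exact (Φ.continuous continuous_snd continuous_fst).dist continuous_const
  · exact isOpen_lt (continuous_id.dist continuous_const)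
      ((continuous_flow Φ 1).dist continuous_const)
  · simpa using hy
  · intro x a b hab hU
    have hshift : ∀ c, ∫ s in (0 : ℝ)..1, dist (Φ s (Φ c x)) y =
        ∫ s in c..(c + 1), dist (Φ s x) y := by
      intro c
      have := intervalIntegral.integral_comp_add_right (a := 0) (b := 1)
        (fun s => dist (Φ s x) y) c
      rw [zero_add, add_comm 1 c] at this
      rw [← this]
      simp_rw [Φ.map_add]
    have hii : ∀ c d, IntervalIntegrable (fun s => dist (Φ s x) y) MeasureTheory.volume c d :=
      fun c d => (hdist x).intervalIntegrable c d
    simp only [hshift]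
    rw [← sub_pos, intervalIntegral.integral_interval_sub_interval_comm' (hii _ _) (hii _ _) (hii _ _),
      sub_pos, ← intervalIntegral.integral_comp_add_right (fun s => dist (Φ s x) y) 1]
    have hlt : ∀ t ∈ Icc a b, dist (Φ t x) y < dist (Φ (t + 1) x) y := fun t ht => by
      have := hU t ht
      rwa [mem_ofPred_eq, ← Φ.map_add, add_comm] at this
    exact intervalIntegral.integral_lt_integral_of_continuousOn_of_le_of_exists_lt hab
      (hdist x).continuousOn ((hdist x).comp (continuous_add_const 1)).continuousOn
      (fun t ht => (hlt t (Ioc_subset_Icc_self ht)).le)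
      ⟨a, left_mem_Icc.2 hab.le, hlt a (left_mem_Icc.2 hab.le)⟩

/-- A set which locally meets each flow line of nearby points exactly once. -/
structure IsTransversal (Φ : Flow ℝ Y) (S : Set Y) : Prop where
  /-- the return times of the flow to the set are bounded away from `0` -/
  eq_zero_of_mem : ∀ x ∈ S, ∃ ε > 0, ∀ t ∈ Icc (-ε) ε, Φ t x ∈ S → t = 0
  /-- points near a point of the set flow to nearby points of the set -/
  eventually_exists : ∀ x ∈ S, ∀ N ∈ 𝓝 x, ∀ᶠ x' in 𝓝 x, ∃ t : ℝ, Φ t x' ∈ S ∩ N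

/-- Take a level set of a function increasing along the flow: strict monotonicity isolates return
times, and the intermediate value theorem makes nearby flow lines hit it. -/
theorem exists_isTransversal (Φ : Flow ℝ Y) {y : Y} (hy : Φ 1 y ≠ y) :
    ∃ S, y ∈ S ∧ IsTransversal Φ S := by
  obtain ⟨h, U, hh, hU, hyU, hmono⟩ := exists_increasing_along_flow Φ hy
  have hbox : ∀ x, ∀ N ∈ 𝓝 x, ∃ ε > 0, ∀ t ∈ Icc (-ε) ε, Φ t x ∈ N := by
    intro x N hN
    have h1 : Tendsto (fun t : ℝ => Φ t x) (𝓝 0) (𝓝 x) := by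
      simpa using (Φ.continuous continuous_id continuous_const : Continuous fun t : ℝ => Φ t x).tendsto 0
    obtain ⟨ε, hε, h2⟩ := Metric.nhds_basis_closedBall.mem_iff.1 (h1 hN)
    refine ⟨ε, hε, fun t ht => h2 ?_⟩
    rwa [Real.closedBall_eq_Icc, zero_sub, zero_add]
  refine ⟨{x | x ∈ U ∧ h x = h y}, ⟨hyU, rfl⟩, ?_, ?_⟩
  · rintro x ⟨hxU, hx⟩
    obtain ⟨ε, hε, hεU⟩ := hbox x U (hU.mem_nhds hxU)
    refine ⟨ε, hε, ?_⟩
    rintro t ⟨ht1, ht2⟩ ⟨-, ht⟩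
    by_contra hne
    rcases lt_or_gt_of_ne hne with hlt | hlt
    · have := hmono x t 0 hlt fun s hs => hεU s ⟨ht1.trans hs.1, hs.2.trans hε.le⟩
      rw [Φ.map_zero_apply, ht, hx] at this
      exact this.false
    · have := hmono x 0 t hlt fun s hs => hεU s ⟨(neg_nonpos.2 hε.le).trans hs.1, hs.2.trans ht2⟩
      rw [Φ.map_zero_apply, ht, hx] at this
      exact this.false
  · rintro x ⟨hxU, hx⟩ N hN
    obtain ⟨ε, hε, hεN⟩ := hbox x (interior (N ∩ U))
      (isOpen_interior.mem_nhds (mem_interior_iff_mem_nhds.2 (inter_mem hN (hU.mem_nhds hxU))))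
    have htube : ∀ᶠ x' in 𝓝 x, ∀ t ∈ Icc (-ε) ε, Φ t x' ∈ interior (N ∩ U) := by
      refine isCompact_Icc.eventually_forall_of_forall_eventually fun t ht => ?_
      exact ((Φ.continuous continuous_snd continuous_fst).tendsto (x, t)).eventually
        (isOpen_interior.mem_nhds (hεN t ht))
    have hεU : ∀ t ∈ Icc (-ε) ε, Φ t x ∈ U := fun t ht => (interior_subset (hεN t ht)).2
    have h1 : h (Φ (-ε) x) < h y := by
      have := hmono x (-ε) 0 (neg_neg_of_pos hε) fun t ht => hεU t ⟨ht.1, ht.2.trans hε.le⟩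
      rwa [Φ.map_zero_apply, hx] at this
    have h2 : h y < h (Φ ε x) := by
      have := hmono x 0 ε hε fun t ht => hεU t ⟨(neg_nonpos.2 hε.le).trans ht.1, ht.2⟩
      rwa [Φ.map_zero_apply, hx] at this
    filter_upwards [htube,
      (hh.comp (continuous_flow Φ (-ε))).continuousAt.eventually_lt continuousAt_const h1,
      continuousAt_const.eventually_lt (hh.comp (continuous_flow Φ ε)).continuousAt h2]
      with x' hx' h3 h4
    obtain ⟨t, ht, hty⟩ := intermediate_value_Icc (by linarith : -ε ≤ ε)
      (f := fun t => h (Φ t x'))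
      (hh.comp (Φ.continuous continuous_id continuous_const)).continuousOn ⟨h3.le, h4.le⟩
    exact ⟨t, ⟨(interior_subset (hx' t ht)).2, hty⟩, (interior_subset (hx' t ht)).1⟩

end Transversal

/-! ### The covering dimension of the orbit space -/

section OrbitSpaceDim

variable {G Y : Type*} [Group G] [MetricSpace Y] [MulAction G Y] {Φ : Flow ℝ Y}
  {hY : IsFlowSpace G Φ} {γ : ℝ}

theorem IsTransversal.isOpen_image {S : Set Y} (hS : IsTransversal Φ S) (hY : IsFlowSpace G Φ)
    {B : Set Y} (hB : IsOpen B) : IsOpen (orbitMk hY '' (S ∩ B)) := by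
  rw [isOpen_iff_mem_nhds]
  rintro _ ⟨x, ⟨hxS, hxB⟩, rfl⟩
  refine mem_of_superset ((isOpenQuotientMap_orbitMk hY).isOpenMap.image_mem_nhds
    (hS.eventually_exists x hxS B (hB.mem_nhds hxB))) ?_
  rintro _ ⟨x', ⟨t, ht⟩, rfl⟩
  exact ⟨_, ht, orbitMk_flow t x'⟩

/-- Points of `S` in the orbit of `x` accumulating at `x` would, after reducing times, be `Φ (r -
t₀) x` with `r → t₀`, against the isolation of return times. -/
theorem IsTransversal.eventually_eq [LocallyCompactSpace Y] {S : Set Y} (hS : IsTransversal Φ S)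
    (hax : ∀ y, ∃ (g : G) (t : ℝ), IsAxisWithLength Φ g y t ∧ t ≤ γ) (hY : IsFlowSpace G Φ)
    {x : Y} (hx : x ∈ S) :
    ∀ᶠ x' in 𝓝 x, x' ∈ S → orbitMk hY x = orbitMk hY x' → x' = x := by
  by_contra hcon
  rw [not_eventually, frequently_iff_neBot] at hcon
  obtain ⟨u, hu⟩ := Ultrafilter.exists_le
    (𝓝 x ⊓ 𝓟 {x' | ¬ (x' ∈ S → orbitMk hY x = orbitMk hY x' → x' = x)})
  have hu1 : (u : Filter Y) ≤ 𝓝 x := hu.trans inf_le_left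
  have hu2 := le_principal_iff.1 (hu.trans inf_le_right)
  have key : ∀ x', ∃ (g : G) (r : ℝ), ¬ (x' ∈ S → orbitMk hY x = orbitMk hY x' → x' = x) →
      r ∈ Icc 0 γ ∧ g • Φ r x = x' ∧ x' ∈ S ∧ x' ≠ x := by
    intro x'
    by_cases h : x' ∈ S → orbitMk hY x = orbitMk hY x' → x' = x
    · exact ⟨1, 0, fun h' => (h' h).elim⟩
    · push Not at h
      obtain ⟨h1, h2, h3⟩ := h
      obtain ⟨g, t, h⟩ := orbitMk_eq_iff.1 h2
      obtain ⟨k, m, r, hr, -, hm⟩ := exists_bounded_of_orbit hax hY x t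
      exact ⟨g * k ^ m, r, fun _ => ⟨hr, by rw [mul_smul, ← hm, h], h1, h3⟩⟩
  choose g r hgr using key
  obtain ⟨g₀, t₀, -, hg₀, hlim, h⟩ := hY.exists_limit (l := u) (x := fun _ => x) (x' := id)
    (t := r) (g := g) tendsto_const_nhds hu1
    (by filter_upwards [hu2] with q hq using (hgr q hq).1)
    (by filter_upwards [hu2] with q hq using (hgr q hq).2.1)
  obtain ⟨ε, hε, huniq⟩ := hS.eq_zero_of_mem x hx
  have hnear : ∀ᶠ x' in (u : Filter Y), r x' ∈ Icc (t₀ - ε) (t₀ + ε) :=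
    hlim (Icc_mem_nhds (by linarith) (by linarith))
  obtain ⟨x', h1, h2, h3⟩ := (Eventually.and hu2 (hg₀.and hnear)).exists
  obtain ⟨-, h4, h5, h6⟩ := hgr x' h1
  have h7 : Φ (r x' - t₀) x = x' := by
    nth_rewrite 1 [← h]
    rw [← hY.smul_flow, ← Φ.map_add, sub_add_cancel, ← h2, h4]
  have h8 := huniq (r x' - t₀) ⟨by linarith [h3.1], by linarith [h3.2]⟩ (by rwa [h7])
  rw [h8, Φ.map_zero_apply] at h7
  exact h6 h7.symm

/-- Compact subsets of the orbit space over which a transversal is a section. -/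
theorem coveringDimLE_of_section {n : ℕ} (hn : CoveringDimLE Y n) {S B : Set Y}
    (hS : IsTransversal Φ S) (hB : IsOpen B) {C : Set (OrbitSpace hY)} (hC : IsCompact C)
    (hCS : C ⊆ orbitMk hY '' (S ∩ B))
    (huniq : ∀ x ∈ S ∩ B, ∀ x' ∈ S ∩ B, orbitMk hY x ∈ C → orbitMk hY x = orbitMk hY x' → x = x') :
    CoveringDimLE C n := by
  have := isCompact_iff_compactSpace.1 hC
  choose e he hep using fun z : C => hCS z.2
  -- By uniqueness the section takes values in `N'` over the open image of `S ∩ (B ∩ N')`.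
  have hcont : Continuous e := by
    rw [continuous_iff_continuousAt]
    intro z N hN
    obtain ⟨N', hN'N, hN', hz⟩ := mem_nhds_iff.1 hN
    have hopen := hS.isOpen_image hY (hB.inter hN')
    have hmem : z.1 ∈ orbitMk hY '' (S ∩ (B ∩ N')) := ⟨e z, ⟨(he z).1, (he z).2, hz⟩, hep z⟩
    have hnear : ∀ᶠ z' : C in 𝓝 z, z'.1 ∈ orbitMk hY '' (S ∩ (B ∩ N')) :=
      continuous_subtype_val.continuousAt.eventually (hopen.mem_nhds hmem)
    change ∀ᶠ z' in 𝓝 z, e z' ∈ N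
    filter_upwards [hnear]
    rintro z' ⟨x', ⟨h1, h2, h3⟩, h4⟩
    have h5 : e z' = x' := huniq _ (he z') _ ⟨h1, h2⟩ (by rw [hep]; exact z'.2) (by rw [hep, h4])
    exact hN'N (h5 ▸ h3)
  refine hn.of_isClosedEmbedding (hcont.isClosedEmbedding fun z z' h => ?_)
  exact Subtype.ext (by rw [← hep z, h, hep z'])

theorem coveringDimLE_orbitSpace [LocallyCompactSpace Y] [SecondCountableTopology Y] {n : ℕ}
    (hn : CoveringDimLE Y n)
    (hax : ∀ y, ∃ (g : G) (t : ℝ), IsAxisWithLength Φ g y t ∧ t ≤ γ) (hY : IsFlowSpace G Φ) :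
    CoveringDimLE (OrbitSpace hY) n := by
  have := t2Space_orbitSpace hax hY
  let := metrizableSpaceMetric (OrbitSpace hY)
  have hmove : ∀ y, Φ 1 y ≠ y := fun y h => by
    obtain ⟨g, t, h1, -⟩ := hax y
    exact h1.1 ⟨1, one_pos, h⟩
  choose S hyS hS using fun y => exists_isTransversal Φ (hmove y)
  obtain ⟨T, hT, hTcov⟩ := countable_cover_nhds
    (f := fun z : OrbitSpace hY => orbitMk hY '' (S (Function.surjInv
      (isOpenQuotientMap_orbitMk hY).surjective z) ∩ univ)) (fun z =>
      ((hS _).isOpen_image hY isOpen_univ).mem_nhds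
        ⟨_, ⟨hyS _, mem_univ _⟩, Function.surjInv_eq _ z⟩)
  have := hT.to_subtype
  have := (countable_countableBasis Y).to_subtype
  let A : T → countableBasis Y → Set Y := fun z B =>
    S (Function.surjInv (isOpenQuotientMap_orbitMk hY).surjective z.1) ∩ B.1
  have hAopen : ∀ z (B : countableBasis Y), IsOpen (orbitMk hY '' A z B) := fun z B =>
    (hS _).isOpen_image hY (isOpen_of_mem_countableBasis B.2)
  -- The locus where the transversal piece has two representatives is open, so removing it preserves
  -- closedness. The open images are F_σ, and `compactCovering` makes the pieces compact.
  let D : T → countableBasis Y → Set (OrbitSpace hY) := fun z B =>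
    {w | ∃ x ∈ A z B, ∃ x' ∈ A z B, x ≠ x' ∧ orbitMk hY x = w ∧ orbitMk hY x' = w}
  have hDopen : ∀ z B, IsOpen (D z B) := by
    intro z B
    rw [isOpen_iff_mem_nhds]
    rintro _ ⟨x, hx, x', hx', hne, rfl, hw⟩
    obtain ⟨N, N', hN, hN', hxN, hxN', hdis⟩ := t2_separation hne
    have hBo := isOpen_of_mem_countableBasis B.2
    filter_upwards [((hS _).isOpen_image hY (hBo.inter hN)).mem_nhds ⟨x, ⟨hx.1, hx.2, hxN⟩, rfl⟩,
      ((hS _).isOpen_image hY (hBo.inter hN')).mem_nhds ⟨x', ⟨hx'.1, hx'.2, hxN'⟩, hw⟩]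
    rintro w ⟨a, ⟨ha1, ha2, ha3⟩, ha⟩ ⟨b, ⟨hb1, hb2, hb3⟩, hb⟩
    exact ⟨a, ⟨ha1, ha2⟩, b, ⟨hb1, hb2⟩, hdis.ne_of_mem ha3 hb3, ha, hb⟩
  choose F hFc hFs hFu _ using fun z B => (hAopen z B).exists_iUnion_isClosed
  let C : T × countableBasis Y × ℕ × ℕ → Set (OrbitSpace hY) := fun p =>
    compactCovering (OrbitSpace hY) p.2.2.2 ∩ (F p.1 p.2.1 p.2.2.1 \ D p.1 p.2.1)
  have hCc : ∀ p, IsCompact (C p) := fun p =>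
    (isCompact_compactCovering _ _).inter_right ((hFc _ _ _).sdiff (hDopen _ _))
  refine .of_iUnion C (fun p => (hCc p).isClosed) ?_ fun p => ?_
  · refine eq_univ_of_forall fun w => mem_iUnion.2 ?_
    obtain ⟨z, hz, x, ⟨hx, -⟩, rfl⟩ := mem_iUnion₂.1 (hTcov ▸ mem_univ w)
    -- In a small enough basic set `x` is the only representative of its orbit, so the orbit avoids
    -- `D`.
    obtain ⟨B, hB, hxB, hBs⟩ := (isBasis_countableBasis Y).mem_nhds_iff.1
      ((hS _).eventually_eq hax hY hx)
    have hmem : orbitMk hY x ∈ orbitMk hY '' A ⟨z, hz⟩ ⟨B, hB⟩ := ⟨x, ⟨hx, hxB⟩, rfl⟩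
    rw [← hFu] at hmem
    obtain ⟨i, hi⟩ := mem_iUnion.1 hmem
    obtain ⟨j, hj⟩ := exists_mem_compactCovering (orbitMk hY x)
    refine ⟨⟨⟨z, hz⟩, ⟨B, hB⟩, i, j⟩, hj, hi, ?_⟩
    rintro ⟨a, ha, b, hb, hne, haw, hbw⟩
    exact hne ((hBs ha.2 ha.1 haw.symm).trans (hBs hb.2 hb.1 hbw.symm).symm)
  · refine coveringDimLE_of_section hn (hS _) (isOpen_of_mem_countableBasis p.2.1.2) (hCc p)
      (fun w hw => hFs _ _ _ hw.2.1) fun x hx x' hx' hxC heq => ?_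
    by_contra hne
    exact hxC.2.2 ⟨x, hx, x', hx', hne, rfl, heq.symm⟩

end OrbitSpaceDim

/-! ### Flow invariant covers -/

section Cover

variable {G Y : Type*} [Group G] [MetricSpace Y] [MulAction G Y] {Φ : Flow ℝ Y} {γ : ℝ}

theorem exists_flowInvariant_cover [LocallyCompactSpace Y]
    (hax : ∀ y, ∃ (g : G) (t : ℝ), IsAxisWithLength Φ g y t ∧ t ≤ γ) (hY : IsFlowSpace G Φ)
    {n : WithBot ℕ∞} (hn : CoveringDimLE (OrbitSpace hY) n) :
    ∃ 𝒱 : Set (Set Y), (∀ V ∈ 𝒱, IsOpen V) ∧ (∀ V ∈ 𝒱, IsInvariant Φ V) ∧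
      IsFamilyCover (VCyc G) 𝒱 ∧ collectionDim 𝒱 ≤ n := by
  choose W H hWo hyW hWΦ hH hWH hHW using exists_flowInvariant_nhds hax hY
  have hπ := isOpenQuotientMap_orbitMk hY
  obtain ⟨𝒪, ⟨h𝒪o, h𝒪c⟩, h𝒪r, h𝒪d⟩ := hn (range fun y => orbitMk hY '' W y) (by
    constructor
    · rintro _ ⟨y, rfl⟩
      exact hπ.isOpenMap _ (hWo y)
    · refine eq_univ_of_forall fun z => ?_
      obtain ⟨y, rfl⟩ := hπ.surjective z
      exact ⟨_, ⟨y, rfl⟩, y, hyW y, rfl⟩)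
  have h𝒪r' : ∀ O : 𝒪, ∃ y, O.1 ⊆ orbitMk hY '' W y := fun O => by simpa using h𝒪r O O.2
  choose c hc using h𝒪r'
  let V : G → 𝒪 → Set Y := fun g O => g • W (c O) ∩ orbitMk hY ⁻¹' O
  have hVsmul : ∀ g k O, g • V k O = V (g * k) O := by
    intro g k O
    ext x
    simp only [V, mem_smul_set_iff_inv_smul_mem, mem_inter_iff, mem_preimage, orbitMk_smul,
      mul_smul]
  have hVimage : ∀ g O, orbitMk hY '' V g O = O.1 := by
    intro g O
    rw [image_inter_preimage]
    refine inter_eq_right.2 fun z hz => ?_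
    obtain ⟨x, hx, rfl⟩ := hc O hz
    exact ⟨g • x, smul_mem_smul_set hx, orbitMk_smul g x⟩
  have hmeet : ∀ g k O, (V g O ∩ V k O).Nonempty → k⁻¹ * g ∈ H (c O) := by
    rintro g k O ⟨x, ⟨hx1, -⟩, hx2, -⟩
    refine hWH (c O) _ ⟨k⁻¹ • x, ?_, mem_smul_set_iff_inv_smul_mem.1 hx2⟩
    rw [mul_smul]
    exact smul_mem_smul_set hx1
  have hVeq : ∀ g k O, k⁻¹ * g ∈ H (c O) → V g O = V k O := by
    intro g k O h
    have : g • W (c O) = k • W (c O) := by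
      rw [← mul_inv_cancel_left k g, mul_smul, hHW (c O) _ h]
    simp only [V, this]
  -- Empty `O` are excluded: the empty set is stabilized by all of `G`.
  refine ⟨{U | ∃ g O, O.1.Nonempty ∧ U = V g O}, ?_, ?_, ⟨?_, ?_, ?_⟩, ?_⟩
  · rintro _ ⟨g, O, -, rfl⟩
    refine IsOpen.inter ?_ ((h𝒪o O O.2).preimage hπ.continuous)
    rw [← preimage_smul_inv]
    exact (hWo _).preimage (hY.continuous_smul g⁻¹)
  · rintro _ ⟨g, O, -, rfl⟩ t x ⟨⟨w, hw, rfl⟩, hx⟩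
    refine ⟨⟨Φ t w, hWΦ _ t hw, hY.smul_flow g t w⟩, ?_⟩
    rwa [mem_preimage, orbitMk_flow]
  · rintro _ ⟨k, O, hO, rfl⟩
    have hne : (V k O).Nonempty := by
      rw [← hVimage k O] at hO
      exact hO.of_image
    refine ⟨fun g hg => ?_, ?_⟩
    · rw [hVsmul] at hg ⊢
      exact hVeq _ _ _ (hmeet _ _ _ hg)
    · have hstab : ∀ g, g ∈ MulAction.stabilizer G (V k O) ↔ k⁻¹ * g * k ∈ H (c O) := by
        intro g
        rw [MulAction.mem_stabilizer_iff, hVsmul, mul_assoc]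
        refine ⟨fun h => hmeet _ _ _ ?_, hVeq _ _ _⟩
        rwa [h, inter_self]
      have hconj : MulAction.stabilizer G (V k O) =
          (H (c O)).map (MulAut.conj k).toMonoidHom := by
        ext g
        rw [hstab, Subgroup.mem_map]
        constructor
        · intro h
          exact ⟨_, h, by simp [mul_assoc]⟩
        · rintro ⟨h, hh, rfl⟩
          simpa [mul_assoc] using hh
      rw [hconj]
      let f := (H (c O)).equivMapOfInjective (MulAut.conj k).toMonoidHom (MulAut.conj k).injective
      obtain ⟨Z, hZ, hZi⟩ := hH (c O)
      refine ⟨Z.map f.toMonoidHom,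
        isCyclic_of_surjective _ (f.toMonoidHom.subgroupMap_surjective Z), ?_⟩
      exact ⟨by rw [Subgroup.index_map_of_bijective f.bijective]; exact hZi.index_ne_zero⟩
  · rintro g _ ⟨k, O, hO, rfl⟩
    exact ⟨g * k, O, hO, hVsmul g k O⟩
  · refine eq_univ_of_forall fun x => ?_
    obtain ⟨O, hO, hxO⟩ : orbitMk hY x ∈ ⋃₀ 𝒪 := h𝒪c ▸ mem_univ _
    rw [show O = orbitMk hY '' V 1 ⟨O, hO⟩ from (hVimage 1 ⟨O, hO⟩).symm] at hxO
    obtain ⟨w, hw, hwx⟩ := hxO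
    obtain ⟨g, t, rfl⟩ := orbitMk_eq_iff.1 hwx
    refine ⟨V g ⟨O, hO⟩, ⟨g, ⟨O, hO⟩, ⟨_, hw.2⟩, rfl⟩, ?_, ?_⟩
    · have := hw.1
      rw [one_smul] at this
      exact smul_mem_smul_set (hWΦ _ t this)
    · rw [mem_preimage, orbitMk_smul, orbitMk_flow]
      exact hw.2
  · refine le_trans (iSup₂_le ?_) h𝒪d
    classical
    rintro s ⟨hs0, hs, x, hx⟩
    simp only [mem_iInter] at hx
    -- Sets sharing the point `x` and lying over the same `O` coincide, so passing to images in the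
    -- orbit space loses no member.
    have hinj : InjOn (fun U => orbitMk hY '' U) (s : Set (Set Y)) := by
      intro U hU U' hU' h
      obtain ⟨g, O, -, rfl⟩ := hs hU
      obtain ⟨k, O', -, rfl⟩ := hs hU'
      have hOO' : O = O' := by
        simp only [hVimage] at h
        exact Subtype.ext h
      subst hOO'
      exact hVeq _ _ _ (hmeet _ _ _ ⟨x, hx _ hU, hx _ hU'⟩)
    rw [← Finset.card_image_of_injOn hinj]
    refine le_iSup₂_of_le (s.image fun U => orbitMk hY '' U) ⟨hs0.image _, ?_, orbitMk hY x, ?_⟩ le_rfl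
    · intro O' hO'
      obtain ⟨U, hU, rfl⟩ := Finset.mem_image.1 (Finset.mem_coe.1 hO')
      obtain ⟨g, O, -, rfl⟩ := hs hU
      simp only [hVimage, O.2]
    · simp only [mem_iInter]
      intro O' hO'
      obtain ⟨U, hU, rfl⟩ := Finset.mem_image.1 hO'
      exact ⟨x, hx U hU, rfl⟩

end Cover

end FlowSpace

theorem mainTheorem4 {G : Type*} [Group G] [Countable G]
    {X : Type*} [MetricSpace X] [LocallyCompactSpace X] [SecondCountableTopology X]
    [MulAction G X] (Φ : Flow ℝ X) (hX : FlowSpace.IsFlowSpace G Φ) (γ : ℝ) (hγ : 0 < γ) :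
    ∃ 𝒱 : Set (Set (FlowSpace.axes hX γ)),
      (∀ V ∈ 𝒱, IsOpen V) ∧
      (∀ V ∈ 𝒱, IsInvariant (FlowSpace.axesFlow hX γ) V) ∧
      FlowSpace.IsFamilyCover (FlowSpace.VCyc G) 𝒱 ∧
      FlowSpace.collectionDim 𝒱 ≤ FlowSpace.coveringDim X := by
  have hemb := (FlowSpace.isClosed_axes hX γ).isClosedEmbedding_subtypeVal
  have : LocallyCompactSpace (FlowSpace.axes hX γ) := hemb.locallyCompactSpace
  have : SecondCountableTopology (FlowSpace.axes hX γ) :=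
    inferInstanceAs (SecondCountableTopology (FlowSpace.axes hX γ : Set X))
  have hY := FlowSpace.isFlowSpace_axesFlow hX γ
  have hax := FlowSpace.exists_isAxisWithLength_axesFlow hX γ
  refine FlowSpace.exists_flowInvariant_cover hax hY ?_
  have hdim := FlowSpace.coveringDimLE_coveringDim X
  generalize FlowSpace.coveringDim X = n at hdim ⊢
  -- The sum theorem concerns finite `n`; `⊥` forces `X` to be empty, and `⊤` is no constraint.
  induction n with
  | bot =>
    have := hdim.isEmpty
    have : IsEmpty (FlowSpace.OrbitSpace hY) :=
      ⟨fun z => by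
        obtain ⟨y, -⟩ := (FlowSpace.isOpenQuotientMap_orbitMk hY).surjective z
        exact isEmptyElim y.1⟩
    exact fun 𝒰 _ => ⟨∅, ⟨by simp, Set.eq_univ_of_forall isEmptyElim⟩, by simp [FlowSpace.Refines],
      iSup₂_le fun s hs => (hs.1.ne_empty (Finset.coe_eq_empty.1 (Set.subset_empty_iff.1 hs.2.1))).elim⟩
  | coe n =>
    induction n with
    | top => exact fun 𝒰 h𝒰 => ⟨𝒰, h𝒰, fun U hU => ⟨U, hU, subset_rfl⟩, le_top⟩
    | coe n =>
      exact FlowSpace.coveringDimLE_orbitSpace (hdim.of_isClosedEmbedding hemb) hax hY
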